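/- Let $K$ be a Hilbertian field and let $S$ be a numerical monoid, i.e. a submonoid of $(\mathbb{N}_0,+)$ with $\mathbb{N}_0\setminus S$ finite. Then every class of the $v$-class group $\mathcal{C}_v(K[S])$ of the monoid algebra $K[S]$ contains infinitely many prime divisors of $K[S]$. Here the following definitions are used. A set $H\subseteq K^n$ is a Hilbert set if there are finitely many polynomials $f_1,\dots,f_l\in K[Y_1,\dots,Y_n,X_1,\dots,X_m]$, each irreducible over $K(Y_1,\dots,Y_n)$ (as a polynomial in $X_1,\dots,X_m$), and a nonzero $g\in K[Y_1,\dots,Y_n]$ such that $H$ is the set of all $y\in K^n$ with $g(y)\neq 0$ for which all $f_j(y,X_1,\dots,X_m)$ are irreducible over $K$. The field $K$ is Hilbertian if every Hilbert set is non-empty. For a domain $D$ with quotient field $F$ and a nonzero fractional ideal $I$ put $I^{-1}=\{x\in F: xI\subseteq D\}$ and $I_v=(I^{-1})^{-1}$, and put $(0)_v=(0)$; a fractional $v$-ideal is a fractional ideal $I$ with $I=I_v$, and it is $v$-invertible if $(IJ)_v=D$ for some fractional $v$-ideal $J$. The $v$-invertible fractional $v$-ideals form a group under $I\cdot_v J=(IJ)_v$,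 and $\mathcal{C}_v(D)$ is its quotient by the subgroup of nonzero principal fractional ideals. A prime divisor of $D$ is a $v$-invertible height-one prime ideal of $D$ (a $v$-invertible fractional $v$-ideal that is a prime ideal of height one); it lies in its class in $\mathcal{C}_v(D)$. -/

import Mathlib

open scoped nonZeroDivisors

/-! ### Hilbertian fields -/

/-- A subset `H ⊆ Kⁿ` is a Hilbert set if there are finitely many polynomials
`f₁, …, f_l ∈ K[Y₁, …, Yₙ][X₁, …, X_m]`, irreducible over `K(Y₁, …, Yₙ)`, and a nonzero
`g ∈ K[Y₁, …, Yₙ]` such that `H` consists of the points `y` with `g(y) ≠ 0` at which every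
specialized polynomial `f_j(y, X₁, …, X_m)` is irreducible over `K`. -/
def IsHilbertSet {K : Type*} [Field K] {n : ℕ} (H : Set (Fin n → K)) : Prop :=
  ∃ (m l : ℕ) (f : Fin l → MvPolynomial (Fin m) (MvPolynomial (Fin n) K))
    (g : MvPolynomial (Fin n) K),
    (∀ j, Irreducible (MvPolynomial.map
      (algebraMap (MvPolynomial (Fin n) K) (FractionRing (MvPolynomial (Fin n) K))) (f j))) ∧
    g ≠ 0 ∧
    H = {y | MvPolynomial.eval y g ≠ 0 ∧
      ∀ j, Irreducible (MvPolynomial.map (MvPolynomial.eval y) (f j))}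

/-- A field is Hilbertian if all its Hilbert sets are nonempty. -/
def IsHilbertian (K : Type*) [Field K] : Prop :=
  ∀ (n : ℕ) (H : Set (Fin n → K)), IsHilbertSet H → H.Nonempty

/-! ### Numerical monoids -/

/-- A numerical monoid is a submonoid of `(ℕ, +)` with finite complement. -/
def IsNumericalMonoid (S : AddSubmonoid ℕ) : Prop :=
  ((S : Set ℕ)ᶜ).Finite

/-! ### Fractional `v`-ideals, the `v`-class group and prime divisors of a domain

`I⁻¹ = {x ∈ F | x I ⊆ R}` for a nonzero fractional ideal `I`, and `I_v = (I⁻¹)⁻¹`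
(Mathlib sets `0⁻¹ = 0`, so that `0_v = 0`). -/

namespace FractionalIdeal

variable {R F : Type*} [CommRing R] [IsDomain R] [Field F] [Algebra R F] [IsFractionRing R F]

theorem inv_ne_zero_of_ne_zero {I : FractionalIdeal R⁰ F} (hI : I ≠ 0) : I⁻¹ ≠ 0 := by
  obtain ⟨a, ha, h⟩ := I.isFractional
  intro h0
  have hmem : algebraMap R F a ∈ I⁻¹ := by
    rw [mem_inv_iff hI]
    intro y hy
    obtain ⟨z, hz⟩ := h y hy
    rw [mem_one_iff]
    exact ⟨z, by rw [hz, Algebra.smul_def]⟩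
  rw [h0, mem_zero_iff] at hmem
  exact IsFractionRing.to_map_ne_zero_of_mem_nonZeroDivisors ha hmem

theorem mul_ne_zero_of_ne_zero {I J : FractionalIdeal R⁰ F} (hI : I ≠ 0) (hJ : J ≠ 0) :
    I * J ≠ 0 := by
  intro h
  refine hI (eq_zero_iff.mpr fun x hx => ?_)
  by_contra hx0
  refine hJ (eq_zero_iff.mpr fun y hy => ?_)
  have hxy : x * y ∈ I * J := mul_mem_mul hx hy
  rw [h, mem_zero_iff] at hxy
  exact (mul_eq_zero.mp hxy).resolve_left hx0

theorem le_inv_iff_mul_le_one {I J : FractionalIdeal R⁰ F} (hJ : J ≠ 0) :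
    I ≤ J⁻¹ ↔ I * J ≤ 1 := by
  rw [inv_eq, le_div_iff_mul_le hJ]

/-- The `v`-closure `I_v = (I⁻¹)⁻¹` of a fractional ideal. -/
noncomputable def vClosure (I : FractionalIdeal R⁰ F) : FractionalIdeal R⁰ F := I⁻¹⁻¹

theorem le_vClosure (I : FractionalIdeal R⁰ F) : I ≤ vClosure I := by
  by_cases hI : I = 0
  · rw [hI]; exact zero_le _
  · rw [vClosure, le_inv_iff_mul_le_one (inv_ne_zero_of_ne_zero hI), inv_eq]
    exact mul_one_div_le_one

theorem inv_vClosure (I : FractionalIdeal R⁰ F) : (vClosure I)⁻¹ = I⁻¹ := by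
  by_cases hI : I = 0
  · rw [vClosure, hI, inv_zero', inv_zero', inv_zero']
  · exact le_antisymm
      (inv_anti_mono hI (inv_ne_zero_of_ne_zero (inv_ne_zero_of_ne_zero hI)) (le_vClosure I))
      (le_vClosure I⁻¹)

theorem vClosure_vClosure (I : FractionalIdeal R⁰ F) : vClosure (vClosure I) = vClosure I := by
  rw [vClosure, inv_vClosure, vClosure]

theorem vClosure_vClosure_mul (I J : FractionalIdeal R⁰ F) :
    vClosure (vClosure I * J) = vClosure (I * J) := by
  by_cases hI : I = 0
  · simp [vClosure, hI, inv_zero']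
  by_cases hJ : J = 0
  · simp [hJ]
  have hIv : vClosure I ≠ 0 := inv_ne_zero_of_ne_zero (inv_ne_zero_of_ne_zero hI)
  have h : (vClosure I * J)⁻¹ = (I * J)⁻¹ := by
    refine eq_of_forall_le_iff fun L => ?_
    rw [le_inv_iff_mul_le_one (mul_ne_zero_of_ne_zero hIv hJ),
      le_inv_iff_mul_le_one (mul_ne_zero_of_ne_zero hI hJ),
      mul_comm (vClosure I), mul_comm I, ← mul_assoc, ← mul_assoc,
      ← le_inv_iff_mul_le_one hIv, ← le_inv_iff_mul_le_one hI, inv_vClosure]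
  rw [vClosure, h, vClosure]

theorem vClosure_mul_vClosure (I J : FractionalIdeal R⁰ F) :
    vClosure (I * vClosure J) = vClosure (I * J) := by
  rw [mul_comm, vClosure_vClosure_mul, mul_comm]

theorem vClosure_spanSingleton (x : F) :
    vClosure (spanSingleton R⁰ x) = spanSingleton R⁰ x := by
  simp [vClosure]

theorem vClosure_one : vClosure (1 : FractionalIdeal R⁰ F) = 1 := by
  rw [← spanSingleton_one, vClosure_spanSingleton]

end FractionalIdeal

/-- The fractional `v`-ideals of a domain `R` with quotient field `F`: the fractional ideals `I`
with `I = I_v`. -/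
@[ext]
structure FractionalVIdeal (R F : Type*) [CommRing R] [IsDomain R] [Field F] [Algebra R F]
    [IsFractionRing R F] where
  toFractionalIdeal : FractionalIdeal R⁰ F
  vClosure_eq : FractionalIdeal.vClosure toFractionalIdeal = toFractionalIdeal

namespace FractionalVIdeal

variable {R F : Type*} [CommRing R] [IsDomain R] [Field F] [Algebra R F] [IsFractionRing R F]

/-- The monoid of fractional `v`-ideals under `v`-multiplication `I ·_v J = (I J)_v`, with
identity `R`. Its units are exactly the `v`-invertible fractional `v`-ideals. -/
noncomputable instance : CommMonoid (FractionalVIdeal R F) where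
  mul I J := ⟨FractionalIdeal.vClosure (I.toFractionalIdeal * J.toFractionalIdeal),
    FractionalIdeal.vClosure_vClosure _⟩
  one := ⟨1, FractionalIdeal.vClosure_one⟩
  mul_assoc I J L := by
    apply FractionalVIdeal.ext
    change FractionalIdeal.vClosure (FractionalIdeal.vClosure _ * _) =
      FractionalIdeal.vClosure (_ * FractionalIdeal.vClosure _)
    rw [FractionalIdeal.vClosure_vClosure_mul, FractionalIdeal.vClosure_mul_vClosure, mul_assoc]
  one_mul I := by
    apply FractionalVIdeal.ext
    change FractionalIdeal.vClosure (1 * _) = _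
    rw [one_mul, I.vClosure_eq]
  mul_one I := by
    apply FractionalVIdeal.ext
    change FractionalIdeal.vClosure (_ * 1) = _
    rw [mul_one, I.vClosure_eq]
  mul_comm I J := by
    apply FractionalVIdeal.ext
    change FractionalIdeal.vClosure _ = FractionalIdeal.vClosure _
    rw [mul_comm]

theorem toFractionalIdeal_mul (I J : FractionalVIdeal R F) :
    (I * J).toFractionalIdeal =
      FractionalIdeal.vClosure (I.toFractionalIdeal * J.toFractionalIdeal) := rfl

theorem toFractionalIdeal_one : (1 : FractionalVIdeal R F).toFractionalIdeal = 1 := rfl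

variable (R F) in
/-- The principal fractional ideals `x R`, as a monoid homomorphism from `F`. -/
noncomputable def principal : F →* FractionalVIdeal R F where
  toFun x := ⟨FractionalIdeal.spanSingleton R⁰ x, FractionalIdeal.vClosure_spanSingleton x⟩
  map_one' := FractionalVIdeal.ext FractionalIdeal.spanSingleton_one
  map_mul' x y := by
    apply FractionalVIdeal.ext
    rw [toFractionalIdeal_mul, FractionalIdeal.spanSingleton_mul_spanSingleton,
      FractionalIdeal.vClosure_spanSingleton]

end FractionalVIdeal

/-- The `v`-class group of `R`: the group of `v`-invertible fractional `v`-ideals modulo the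
subgroup of nonzero principal fractional ideals. -/
abbrev VClassGroup (R F : Type*) [CommRing R] [IsDomain R] [Field F] [Algebra R F]
    [IsFractionRing R F] : Type _ :=
  (FractionalVIdeal R F)ˣ ⧸ (Units.map (FractionalVIdeal.principal R F)).range

/-- `P` is a prime divisor of `R` lying in the class `c`: `P` is a height-one prime ideal which is
a `v`-invertible fractional `v`-ideal, and its `v`-class is `c`. -/
def IsPrimeDivisorInClass {R F : Type*} [CommRing R] [IsDomain R] [Field F] [Algebra R F]
    [IsFractionRing R F] (c : VClassGroup R F) (P : Ideal R) : Prop :=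
  P.IsPrime ∧ P.height = 1 ∧
    ∃ I : (FractionalVIdeal R F)ˣ,
      (I : FractionalVIdeal R F).toFractionalIdeal = (P : FractionalIdeal R⁰ F) ∧
      (QuotientGroup.mk I : VClassGroup R F) = c

/-!
The monoid algebra `K[S]` is viewed inside `K[X]`; if `n, n + 1, … ∈ S`, then `Xⁿ K[X]` lies in the
conductor. Write `I_u = u K[X] ∩ K[S]` for the contraction of a principal ideal.

Every class contains some `I_u` with `u(0) ≠ 0` (`exists_spanSingleton_mul_eq_contraction`). Indeed,
let `A` be `v`-invertible with `v`-inverse `B`, and let `M` be the maximal ideal of `K[S]` of elements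
without constant term. If `n` is the least possible exponent, then `Xⁿ⁻¹ M ⊆ K[S]` although
`Xⁿ⁻¹ ∉ K[S]`, so `M⁻¹ ≠ K[S]`, and `A B`, whose `v`-closure is `K[S]`, is not contained in `M`.
Hence `a b ∉ M` for some `a ∈ A`, `b ∈ B`, and `b A` is an integral ideal not contained in `M`. Such
an ideal is the contraction of its extension to `K[X]` (`eq_contraction_of_map_eq_span`), which is
principal.

The class of `I_u` depends only on `u` modulo `Xⁿ` (`exists_contraction_eq_spanSingleton_mul`), so
all `I_p` with `p = u + y Xⁿ`, `y ∈ K`, lie in the given class. The polynomial `u + Y Xⁿ` is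
irreducible over `K(Y)`, as it is linear in `Y` with coprime coefficients, so the Hilbertian field
`K` has infinitely many `y` for which `p` is irreducible
(`IsHilbertian.infinite_irreducible_add_C_mul_X_pow`). For these `y` the ideals `I_p` are pairwise
distinct primes, and they have height one (`height_contraction`).
-/

/-! ### Hilbert's irreducibility property for a linear pencil -/

section Hilbertian

open Polynomial

theorem MvPolynomial.map_uniqueAlgEquiv_symm {R T σ : Type*} [CommSemiring R] [CommSemiring T]
    [Unique σ] (φ : R →+* T) (p : R[X]) :
    MvPolynomial.map φ ((MvPolynomial.uniqueAlgEquiv R σ).symm p) =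
      (MvPolynomial.uniqueAlgEquiv T σ).symm (p.map φ) := by
  ext d
  rw [MvPolynomial.coeff_map, MvPolynomial.coeff_uniqueAlgEquiv_symm,
    MvPolynomial.coeff_uniqueAlgEquiv_symm, Polynomial.coeff_map]

variable {K : Type*} [Field K]

theorem Polynomial.isRelPrime_X_pow {u : K[X]} (hu : u.coeff 0 ≠ 0) (n : ℕ) :
    IsRelPrime (X ^ n) u := by
  refine IsRelPrime.pow_left (irreducible_X.isRelPrime_iff_not_dvd.mpr ?_)
  rwa [X_dvd_iff]

/-- Read as a polynomial in the parameter `Y` over `K[X]`, the pencil `u + Y Xⁿ` is linear with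
coprime coefficients. -/
theorem Polynomial.irreducible_map_C_add_C_X_mul_X_pow {u : K[X]} (hu : u.coeff 0 ≠ 0) (n : ℕ) :
    Irreducible (u.map C + C X * X ^ n : K[X][X]) := by
  rw [← MulEquiv.irreducible_iff (Bivariate.swap (R := K))]
  have h : Bivariate.swap (R := K) (u.map C + C X * X ^ n) = C (X ^ n) * X + C u := by
    rw [map_add, Bivariate.swap_map_C, map_mul, map_pow, Bivariate.swap_X, Bivariate.swap_Y,
      ← C_pow, mul_comm, add_comm]
  rw [h]
  exact irreducible_C_mul_X_add_C (pow_ne_zero _ X_ne_zero) (isRelPrime_X_pow hu n)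

/-- The generic member of the pencil is irreducible over the field of rational functions in the
parameter, by Gauss's lemma: it is primitive, since its constant coefficient `u(0)` is a unit. -/
theorem Polynomial.irreducible_map_fractionRing_add_mul_X_pow {u : K[X]} (hu : u.coeff 0 ≠ 0)
    {n : ℕ} (hn : n ≠ 0) :
    Irreducible ((u.map MvPolynomial.C + C (MvPolynomial.X 0) * X ^ n :
      (MvPolynomial (Fin 1) K)[X]).map
        (algebraMap (MvPolynomial (Fin 1) K) (FractionRing (MvPolynomial (Fin 1) K)))) := by
  have hprim : (u.map MvPolynomial.C + C (MvPolynomial.X 0) * X ^ n :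
      (MvPolynomial (Fin 1) K)[X]).IsPrimitive := by
    intro r hr
    have h0 := (C_dvd_iff_dvd_coeff _ _).mp hr 0
    rw [coeff_add, coeff_map, coeff_C_mul, coeff_X_pow, if_neg hn.symm, mul_zero, add_zero] at h0
    exact isUnit_of_dvd_unit h0 ((isUnit_iff_ne_zero.mpr hu).map MvPolynomial.C)
  rw [← hprim.irreducible_iff_irreducible_map_fraction_map,
    ← MulEquiv.irreducible_iff (mapEquiv (MvPolynomial.uniqueAlgEquiv K (Fin 1)).toRingEquiv)]
  convert irreducible_map_C_add_C_X_mul_X_pow hu n using 1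
  rw [mapEquiv_apply, Polynomial.map_add, Polynomial.map_mul, Polynomial.map_pow, map_X, map_C,
    Polynomial.map_map]
  congr 2
  · ext a
    simp
  · simp

/-- Excluding finitely many parameters only changes the polynomial `g` in the definition of a
Hilbert set, so nonemptiness of all Hilbert sets gives infinitely many irreducible
specializations. -/
theorem IsHilbertian.infinite_irreducible_add_C_mul_X_pow (hK : IsHilbertian K) {u : K[X]}
    (hu : u.coeff 0 ≠ 0) {n : ℕ} (hn : n ≠ 0) :
    {y : K | Irreducible (u + C y * X ^ n)}.Infinite := by
  intro hfin
  obtain ⟨y, hy0, hy⟩ := hK 1 _ ⟨1, 1,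
    fun _ => (MvPolynomial.uniqueAlgEquiv (MvPolynomial (Fin 1) K) (Fin 1)).symm
      (u.map MvPolynomial.C + C (MvPolynomial.X 0) * X ^ n),
    ∏ a ∈ hfin.toFinset, (MvPolynomial.X 0 - MvPolynomial.C a), fun _ => by
      rw [MvPolynomial.map_uniqueAlgEquiv_symm, MulEquiv.irreducible_iff]
      exact irreducible_map_fractionRing_add_mul_X_pow hu hn, by
      refine Finset.prod_ne_zero_iff.mpr fun a _ h => ?_
      have := congrArg (MvPolynomial.eval fun _ => a + 1) h
      simp at this, rfl⟩
  have hirr := hy 0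
  rw [MvPolynomial.map_uniqueAlgEquiv_symm, MulEquiv.irreducible_iff, Polynomial.map_add,
    Polynomial.map_mul, Polynomial.map_pow, map_X, map_C, MvPolynomial.eval_X,
    Polynomial.map_map] at hirr
  have hC : (MvPolynomial.eval y).comp MvPolynomial.C = RingHom.id K := by ext; simp
  rw [hC, Polynomial.map_id] at hirr
  refine hy0 ?_
  rw [map_prod]
  exact Finset.prod_eq_zero (hfin.mem_toFinset.mpr hirr) (by simp)

end Hilbertian

/-! ### The monoid algebra as a subring of the polynomial ring -/

namespace NumericalMonoidAlgebra

open Polynomial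

variable {K : Type*} [Field K] (S : AddSubmonoid ℕ)

/-- The inclusion `K[S] → K[X]` induced by `S ⊆ ℕ`. -/
noncomputable def toPolynomial : AddMonoidAlgebra K S →+* K[X] :=
  (toFinsuppIso K).symm.toRingHom.comp (AddMonoidAlgebra.mapDomainRingHom K S.subtype)

theorem toPolynomial_injective : Function.Injective (toPolynomial (K := K) S) :=
  (toFinsuppIso K).symm.injective.comp
    (AddMonoidAlgebra.mapDomain_injective Subtype.val_injective)

variable {S}

theorem coeff_toPolynomial_of_notMem (d : AddMonoidAlgebra K S) {k : ℕ} (hk : k ∉ S) :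
    (toPolynomial S d).coeff k = 0 :=
  Finsupp.mapDomain_of_notMem_range _ _ (by rintro ⟨s, rfl⟩; exact hk s.2)

theorem exists_toPolynomial_eq {p : K[X]} (hp : ∀ k ∉ S, p.coeff k = 0) :
    ∃ d : AddMonoidAlgebra K S, toPolynomial S d = p := by
  refine ⟨.ofCoeff (p.toFinsupp.coeff.comapDomain ((↑) : S → ℕ)
    Subtype.val_injective.injOn), ?_⟩
  refine (toFinsuppIso K).injective ?_
  refine AddMonoidAlgebra.coeff_injective ?_
  refine Finsupp.mapDomain_comapDomain _ Subtype.val_injective _ ?_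
  intro k hk
  by_contra h
  exact Finsupp.mem_support_iff.mp hk (hp k fun hkS => h ⟨⟨k, hkS⟩, rfl⟩)

theorem exists_toPolynomial_eq_C (a : K) : ∃ d : AddMonoidAlgebra K S, toPolynomial S d = C a :=
  exists_toPolynomial_eq fun k hk => by
    rw [coeff_C, if_neg]
    rintro rfl
    exact hk S.zero_mem

/-- If `n, n + 1, … ∈ S`, then `Xⁿ K[X]` lies in the conductor of `K[S]` in `K[X]`. -/
theorem exists_toPolynomial_eq_X_pow_mul {n : ℕ} (hn : ∀ k, n ≤ k → k ∈ S) (p : K[X]) :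
    ∃ d : AddMonoidAlgebra K S, toPolynomial S d = X ^ n * p :=
  exists_toPolynomial_eq fun k hk => by
    rw [coeff_X_pow_mul', if_neg fun h => hk (hn k h)]

/-! ### Contractions of principal ideals of the polynomial ring -/

variable (S) in
/-- The contraction `p K[X] ∩ K[S]`. -/
noncomputable def contraction (p : K[X]) : Ideal (AddMonoidAlgebra K S) :=
  (Ideal.span {p}).comap (toPolynomial S)

theorem mem_contraction {p : K[X]} {d : AddMonoidAlgebra K S} :
    d ∈ contraction S p ↔ p ∣ toPolynomial S d :=
  Ideal.mem_comap.trans Ideal.mem_span_singleton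

/-- If `p ≡ q` modulo `Xⁿ K[X]`, which lies in the conductor, then `q · (p K[X] ∩ K[S])` is
contained in `p · (q K[X] ∩ K[S])`. The factors `Xⁿ` in `a = Xⁿ p` and `b = Xⁿ q` move `p` and `q`
into `K[S]`. -/
theorem span_mul_contraction_le {n : ℕ} (hn : ∀ k, n ≤ k → k ∈ S) {p q : K[X]}
    (hpq : X ^ n ∣ q - p) {a b : AddMonoidAlgebra K S}
    (ha : toPolynomial S a = X ^ n * p) (hb : toPolynomial S b = X ^ n * q) :
    Ideal.span {b} * contraction S p ≤ Ideal.span {a} * contraction S q := by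
  intro x hx
  obtain ⟨z, hz, rfl⟩ := Ideal.mem_span_singleton_mul.mp hx
  obtain ⟨g, hg⟩ := mem_contraction.mp hz
  obtain ⟨h, hh⟩ := hpq
  obtain ⟨t, ht⟩ := exists_toPolynomial_eq_X_pow_mul hn (h * g)
  -- `q g = p g + (q - p) g`, where both summands lie in `K[S]`
  have hw : toPolynomial S (z + t) = q * g := by
    rw [map_add, ht, hg, ← mul_assoc, ← hh]
    ring
  refine Ideal.mem_span_singleton_mul.mpr ⟨z + t, mem_contraction.mpr ⟨g, hw⟩, ?_⟩
  apply toPolynomial_injective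
  rw [map_mul, map_mul, hw, ha, hb, hg]
  ring

theorem coeff_zero_ne_zero_of_dvd {p q : K[X]} (h : p ∣ q) (hq : q.coeff 0 ≠ 0) :
    p.coeff 0 ≠ 0 := by
  rintro hp
  obtain ⟨r, rfl⟩ := h
  rw [mul_coeff_zero, hp, zero_mul] at hq
  exact hq rfl

theorem not_dvd_X_pow {p : K[X]} (hp : Irreducible p) (hp0 : p.coeff 0 ≠ 0) (n : ℕ) :
    ¬ p ∣ X ^ n := by
  intro h
  exact hp0 (X_dvd_iff.mp (hp.dvd_symm irreducible_X (hp.prime.dvd_of_dvd_pow h)))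

theorem isPrime_contraction {p : K[X]} (hp : Irreducible p) : (contraction S p).IsPrime :=
  have : (Ideal.span {p}).IsPrime := (Ideal.span_singleton_prime hp.ne_zero).mpr hp.prime
  Ideal.comap_isPrime _ _

theorem contraction_ne_bot {n : ℕ} (hn : ∀ k, n ≤ k → k ∈ S) {p : K[X]} (hp : p ≠ 0) :
    contraction S p ≠ ⊥ := by
  obtain ⟨a, ha⟩ := exists_toPolynomial_eq_X_pow_mul hn p
  refine (Submodule.ne_bot_iff _).mpr ⟨a, mem_contraction.mpr ⟨X ^ n, by rw [ha, mul_comm]⟩, ?_⟩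
  rintro rfl
  rw [map_zero] at ha
  exact mul_ne_zero (pow_ne_zero n X_ne_zero) hp ha.symm

/-- A nonzero prime contained in the contraction of an irreducible `p ≠ X` equals it: the
conductor element `Xⁿ` and the cofactor of the `p`-part of any element avoid it, so that it
contains `Xⁿ p` and then every multiple of `p`. -/
theorem eq_contraction_of_le {n : ℕ} (hn : ∀ k, n ≤ k → k ∈ S) {p : K[X]} (hp : Irreducible p)
    (hp0 : p.coeff 0 ≠ 0) {Q : Ideal (AddMonoidAlgebra K S)} (hQ : Q.IsPrime) (hQ0 : Q ≠ ⊥)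
    (hle : Q ≤ contraction S p) : Q = contraction S p := by
  obtain ⟨d, hdQ, hd0⟩ := (Submodule.ne_bot_iff _).mp hQ0
  have hfin : FiniteMultiplicity p (toPolynomial S d) :=
    FiniteMultiplicity.of_prime_left hp.prime
      ((map_ne_zero_iff _ (toPolynomial_injective S)).mpr hd0)
  obtain ⟨h, hdh, hph⟩ := hfin.exists_eq_pow_mul_and_not_dvd
  set k := multiplicity p (toPolynomial S d)
  obtain ⟨a, ha⟩ := exists_toPolynomial_eq_X_pow_mul hn p
  obtain ⟨b, hb⟩ := exists_toPolynomial_eq_X_pow_mul hn h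
  obtain ⟨t, ht⟩ := exists_toPolynomial_eq_X_pow_mul (K := K) hn 1
  rw [mul_one] at ht
  have hbQ : b ∉ Q := fun hbQ => by
    have := mem_contraction.mp (hle hbQ)
    rw [hb] at this
    exact (hp.prime.dvd_or_dvd this).elim (not_dvd_X_pow hp hp0 n) hph
  have htQ : t ∉ Q := fun htQ => by
    have := mem_contraction.mp (hle htQ)
    rw [ht] at this
    exact not_dvd_X_pow hp hp0 n this
  have haQ : a ∈ Q := by
    have hab : a ^ k * b = t ^ (k + 1) * d := by
      apply toPolynomial_injective
      rw [map_mul, map_mul, map_pow, map_pow, ha, hb, ht, hdh]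
      ring
    have : a ^ k * b ∈ Q := hab ▸ Q.mul_mem_left _ hdQ
    exact hQ.mem_of_pow_mem k ((hQ.mem_or_mem this).resolve_right hbQ)
  refine le_antisymm hle fun x hx => ?_
  obtain ⟨g, hg⟩ := mem_contraction.mp hx
  obtain ⟨s, hs⟩ := exists_toPolynomial_eq_X_pow_mul hn g
  have hsa : t ^ 2 * x = s * a := by
    apply toPolynomial_injective
    rw [map_mul, map_mul, map_pow, ha, hs, ht, hg]
    ring
  have : t ^ 2 * x ∈ Q := hsa ▸ Q.mul_mem_left _ haQ
  exact (hQ.mem_or_mem this).resolve_left fun h => htQ (hQ.mem_of_pow_mem 2 h)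

theorem height_contraction {n : ℕ} (hn : ∀ k, n ≤ k → k ∈ S) {p : K[X]} (hp : Irreducible p)
    (hp0 : p.coeff 0 ≠ 0) : (contraction S p).height = 1 := by
  have := isPrime_contraction (S := S) hp
  refine le_antisymm ?_ ?_
  · refine (Ideal.height_le_iff (n := 1)).mpr fun Q hQ hlt => ?_
    by_cases hQ0 : Q = ⊥
    · rw [hQ0, Ideal.height_bot]
      exact zero_lt_one
    · exact absurd (eq_contraction_of_le hn hp hp0 hQ hQ0 hlt.le) hlt.ne
  · rw [Order.one_le_iff_ne_zero, Ne, Ideal.height_eq_zero_iff_eq_bot]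
    exact contraction_ne_bot hn hp.ne_zero

/-- Distinct members of the pencil `u + y Xⁿ` have distinct contractions. -/
theorem contraction_add_C_mul_X_pow_injOn {n : ℕ} (hn : ∀ k, n ≤ k → k ∈ S) (hn0 : n ≠ 0)
    {u : K[X]} (hu : u.coeff 0 ≠ 0) :
    Set.InjOn (fun y : K => contraction S (u + C y * X ^ n))
      {y | Irreducible (u + C y * X ^ n)} := by
  intro y hy z hz hyz
  have hcoeff (w : K) : (u + C w * X ^ n).coeff 0 = u.coeff 0 := by
    rw [coeff_add, coeff_C_mul, coeff_X_pow, if_neg hn0.symm, mul_zero, add_zero]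
  obtain ⟨a, ha⟩ := exists_toPolynomial_eq_X_pow_mul hn (u + C y * X ^ n)
  have hmem : a ∈ contraction S (u + C z * X ^ n) := by
    change contraction S (u + C y * X ^ n) = contraction S (u + C z * X ^ n) at hyz
    rw [← hyz, mem_contraction, ha]
    exact dvd_mul_left _ _
  rw [mem_contraction, ha] at hmem
  have hdvd := (hz.prime.dvd_or_dvd hmem).resolve_left
    (not_dvd_X_pow hz (by rwa [hcoeff]) n)
  obtain ⟨v, hv⟩ := (hz.dvd_irreducible_iff_associated hy).mp hdvd
  obtain ⟨r, -, hr⟩ := Polynomial.isUnit_iff.mp v.isUnit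
  rw [← hr] at hv
  have hr1 : r = 1 := by
    have h0 := congrArg (fun f => coeff f 0) hv
    simp only [coeff_mul_C, hcoeff] at h0
    exact mul_left_cancel₀ hu (h0.trans (mul_one _).symm)
  rw [hr1, C_1, mul_one] at hv
  have hc := mul_right_cancel₀ (pow_ne_zero n X_ne_zero) (add_left_cancel hv)
  exact (C_injective hc).symm

/-- An ideal of `K[S]` containing an element with nonzero constant coefficient is determined by
its extension to `K[X]`: the elements of `K[S]` multiplying the contraction of the extension into
the ideal form an ideal which contains `Xⁿ K[X]` and that element, hence a unit. -/
theorem eq_contraction_of_map_eq_span {n : ℕ} (hn : ∀ k, n ≤ k → k ∈ S)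
    {I : Ideal (AddMonoidAlgebra K S)} {e : AddMonoidAlgebra K S} (heI : e ∈ I)
    (he : (toPolynomial S e).coeff 0 ≠ 0) {u : K[X]}
    (hu : I.map (toPolynomial S) = Ideal.span {u}) : I = contraction S u := by
  have hcond : ∀ y ∈ I.map (toPolynomial S), ∀ g,
      ∃ d ∈ I, toPolynomial S d = X ^ n * (g * y) := by
    intro y hy
    refine Submodule.span_induction ?_ (fun g => ⟨0, I.zero_mem, by simp⟩) ?_ ?_ hy
    · rintro _ ⟨d, hd, rfl⟩ g
      obtain ⟨t, ht⟩ := exists_toPolynomial_eq_X_pow_mul hn g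
      exact ⟨t * d, I.mul_mem_left _ hd, by rw [map_mul, ht, mul_assoc]⟩
    · rintro y z - - hy hz g
      obtain ⟨d, hd, hdy⟩ := hy g
      obtain ⟨d', hd', hdz⟩ := hz g
      exact ⟨d + d', I.add_mem hd hd', by rw [map_add, hdy, hdz, mul_add, mul_add]⟩
    · rintro r y - hy g
      obtain ⟨d, hd, hdy⟩ := hy (g * r)
      exact ⟨d, hd, by rw [hdy, smul_eq_mul, mul_assoc]⟩
  refine le_antisymm (fun x hx => ?_) fun x hx => ?_
  · exact Ideal.mem_comap.mpr (hu ▸ Ideal.mem_map_of_mem _ hx)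
  · have hxI : toPolynomial S x ∈ I.map (toPolynomial S) := hu ▸ Ideal.mem_comap.mp hx
    -- `e = c - m` with `c` a nonzero constant and `m` without constant term, so that `e` divides
    -- `cⁿ - mⁿ`, where `mⁿ` lies in the conductor
    obtain ⟨c, hc⟩ := exists_toPolynomial_eq_C (S := S) ((toPolynomial S e).coeff 0)
    obtain ⟨b, hb⟩ := exists_toPolynomial_eq_C (S := S) ((toPolynomial S e).coeff 0)⁻¹
    have hbc : b * c = 1 := by
      apply toPolynomial_injective
      rw [map_mul, hb, hc, ← C_mul, inv_mul_cancel₀ he, C_1, map_one]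
    obtain ⟨g, hg⟩ : X ∣ toPolynomial S (c - e) := by
      rw [X_dvd_iff, map_sub, coeff_sub, hc, coeff_C_zero, sub_self]
    obtain ⟨d, hdI, hd⟩ := hcond _ hxI (g ^ n)
    have hm : (c - e) ^ n * x ∈ I := by
      convert hdI
      apply toPolynomial_injective
      rw [map_mul, map_pow, hg, hd, mul_pow, mul_assoc]
    have hcm : (c ^ n - (c - e) ^ n) * x ∈ I := by
      obtain ⟨s, hs⟩ := sub_dvd_pow_sub_pow c (c - e) n
      rw [sub_sub_cancel] at hs
      rw [hs, mul_assoc]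
      exact I.mul_mem_right _ heI
    have hcx : c ^ n * x ∈ I := by
      convert I.add_mem hcm hm using 1
      ring
    have := I.mul_mem_left (b ^ n) hcx
    rwa [← mul_assoc, ← mul_pow, hbc, one_pow, one_mul] at this

end NumericalMonoidAlgebra

/-! ### Principal multiples of fractional `v`-ideals -/

namespace FractionalIdeal

variable {R F : Type*} [CommRing R] [IsDomain R] [Field F] [Algebra R F] [IsFractionRing R F]

theorem vClosure_spanSingleton_mul {x : F} (hx : x ≠ 0) {I : FractionalIdeal R⁰ F}
    (hI : vClosure I = I) : vClosure (spanSingleton R⁰ x * I) = spanSingleton R⁰ x * I := by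
  refine le_antisymm ?_ (le_vClosure _)
  have h : spanSingleton R⁰ x⁻¹ * vClosure (spanSingleton R⁰ x * I) ≤ I := by
    refine (le_vClosure _).trans_eq ?_
    rw [vClosure_mul_vClosure, ← mul_assoc, spanSingleton_mul_spanSingleton, inv_mul_cancel₀ hx,
      spanSingleton_one, one_mul, hI]
  calc vClosure (spanSingleton R⁰ x * I)
      = spanSingleton R⁰ x * (spanSingleton R⁰ x⁻¹ * vClosure (spanSingleton R⁰ x * I)) := by
        rw [← mul_assoc, spanSingleton_mul_spanSingleton, mul_inv_cancel₀ hx, spanSingleton_one,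
          one_mul]
    _ ≤ _ := mul_le_mul_right h _

end FractionalIdeal

namespace FractionalVIdeal

variable {R F : Type*} [CommRing R] [IsDomain R] [Field F] [Algebra R F] [IsFractionRing R F]

/-- A nonzero principal multiple of a `v`-invertible fractional `v`-ideal is again one, in the
same class. -/
theorem exists_unit_toFractionalIdeal_eq (I : (FractionalVIdeal R F)ˣ) {x : F} (hx : x ≠ 0) :
    ∃ J : (FractionalVIdeal R F)ˣ,
      (J : FractionalVIdeal R F).toFractionalIdeal =
        FractionalIdeal.spanSingleton R⁰ x * (I : FractionalVIdeal R F).toFractionalIdeal ∧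
      (QuotientGroup.mk J : VClassGroup R F) = QuotientGroup.mk I := by
  refine ⟨Units.map (principal R F) (Units.mk0 x hx) * I, ?_, ?_⟩
  · exact FractionalIdeal.vClosure_spanSingleton_mul hx (I : FractionalVIdeal R F).vClosure_eq
  · rw [QuotientGroup.mk_mul,
      (QuotientGroup.eq_one_iff (N := (Units.map (principal R F)).range) _).mpr ⟨_, rfl⟩, one_mul]

end FractionalVIdeal

/-! ### The classes of the monoid algebra -/

namespace NumericalMonoidAlgebra

open Polynomial FractionalIdeal

variable {K : Type*} [Field K] {S : AddSubmonoid ℕ}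

/-- A numerical monoid has a least `n` with `n, n + 1, … ∈ S`; minimality says that `n - 1`, if it
is a natural number, is a gap. -/
theorem exists_conductor (hS : IsNumericalMonoid S) :
    ∃ n, (∀ k, n ≤ k → k ∈ S) ∧ ∀ k, k + 1 = n → k ∉ S := by
  classical
  have hex : ∃ n, ∀ k, n ≤ k → k ∈ S := by
    obtain ⟨b, hb⟩ := hS.bddAbove
    exact ⟨b + 1, fun k hk => by_contra fun h => absurd (hb h) (by omega)⟩
  refine ⟨Nat.find hex, Nat.find_spec hex, fun k hk hkS => ?_⟩
  refine Nat.find_min hex (m := k) (by omega) fun j hj => ?_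
  rcases hj.eq_or_lt with rfl | hlt
  · exact hkS
  · exact Nat.find_spec hex j (by omega)

/-- A fractional ideal inside `K[S]` with `v`-closure `K[S]` contains an element with nonzero
constant coefficient. Otherwise its inverse contains `Xⁿ⁻¹`, for the conductor exponent `n`, and
this is not an element of `K[S]`. -/
theorem exists_coeff_zero_ne_zero_of_vClosure_eq_one (hS : IsNumericalMonoid S)
    {F : Type*} [Field F] [Algebra (AddMonoidAlgebra K S) F]
    [IsFractionRing (AddMonoidAlgebra K S) F]
    {L : FractionalIdeal (AddMonoidAlgebra K S)⁰ F} (hL : vClosure L = 1) :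
    ∃ d : AddMonoidAlgebra K S, algebraMap _ F d ∈ L ∧ (toPolynomial S d).coeff 0 ≠ 0 := by
  by_contra! hcon
  obtain ⟨n, hn, hgap⟩ := exists_conductor hS
  have hL0 : L ≠ 0 := by
    rintro rfl
    rw [vClosure, inv_zero', inv_zero'] at hL
    exact zero_ne_one hL
  -- `Xⁿ⁻¹` is written as `X²ⁿ / Xⁿ⁺¹`, which also covers `n = 0`
  obtain ⟨s, hs⟩ := exists_toPolynomial_eq_X_pow_mul (K := K) hn (X ^ n)
  obtain ⟨t, ht⟩ := exists_toPolynomial_eq_X_pow_mul (K := K) hn X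
  have ht0 : algebraMap _ F t ≠ 0 := by
    rw [Ne, map_eq_zero_iff _ (IsFractionRing.injective (AddMonoidAlgebra K S) F)]
    rintro rfl
    rw [map_zero] at ht
    exact mul_ne_zero (pow_ne_zero n X_ne_zero) X_ne_zero ht.symm
  have hmem : algebraMap _ F s / algebraMap _ F t ∈ L⁻¹ := by
    rw [mem_inv_iff hL0]
    intro y hy
    obtain ⟨d, rfl⟩ := (mem_one_iff _).mp (hL ▸ le_vClosure L hy)
    obtain ⟨g, hg⟩ := X_dvd_iff.mpr (hcon d hy)
    obtain ⟨d', hd'⟩ := exists_toPolynomial_eq_X_pow_mul hn g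
    refine (mem_one_iff _).mpr ⟨d', ?_⟩
    rw [div_mul_eq_mul_div, eq_div_iff ht0, ← map_mul, ← map_mul]
    congr 1
    apply toPolynomial_injective
    rw [map_mul, map_mul, hs, ht, hg, hd']
    ring
  rw [← inv_vClosure, hL, inv_one] at hmem
  obtain ⟨d, hd⟩ := (mem_one_iff _).mp hmem
  rw [eq_div_iff ht0, ← map_mul] at hd
  have hd' := congrArg (toPolynomial S) (IsFractionRing.injective _ F hd)
  rw [map_mul, hs, ht, mul_left_comm] at hd'
  have hdX := mul_left_cancel₀ (pow_ne_zero n X_ne_zero) hd'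
  cases n with
  | zero =>
    have := congrArg (fun f => coeff f 0) hdX
    simp at this
  | succ k =>
    rw [pow_succ] at hdX
    have hk := coeff_toPolynomial_of_notMem d (hgap k rfl)
    rw [mul_right_cancel₀ X_ne_zero hdX, coeff_X_pow_self] at hk
    exact one_ne_zero hk

/-- Every `v`-invertible fractional `v`-ideal of `K[S]` is a nonzero principal multiple of the
contraction of some `u K[X]` with `u(0) ≠ 0`. -/
theorem exists_spanSingleton_mul_eq_contraction (hS : IsNumericalMonoid S)
    {F : Type*} [Field F] [Algebra (AddMonoidAlgebra K S) F]
    [IsFractionRing (AddMonoidAlgebra K S) F] (I : (FractionalVIdeal (AddMonoidAlgebra K S) F)ˣ) :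
    ∃ x : F, x ≠ 0 ∧ ∃ u : K[X], u.coeff 0 ≠ 0 ∧
      spanSingleton (AddMonoidAlgebra K S)⁰ x *
        (I : FractionalVIdeal (AddMonoidAlgebra K S) F).toFractionalIdeal = contraction S u := by
  obtain ⟨n, hn, -⟩ := exists_conductor hS
  set A := (I : FractionalVIdeal (AddMonoidAlgebra K S) F).toFractionalIdeal
  set B := (↑I⁻¹ : FractionalVIdeal (AddMonoidAlgebra K S) F).toFractionalIdeal
  have hAB : vClosure (A * B) = 1 := congrArg FractionalVIdeal.toFractionalIdeal I.mul_inv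
  have hle : A * B ≤ 1 := hAB ▸ le_vClosure _
  obtain ⟨d, hd, hd0⟩ := exists_coeff_zero_ne_zero_of_vClosure_eq_one hS hAB
  -- the elements without constant term are closed under addition, so a product `a b` avoids them
  obtain ⟨a, ha, b, hb, e, he, he0⟩ : ∃ a ∈ A, ∃ b ∈ B, ∃ e : AddMonoidAlgebra K S,
      algebraMap _ F e = a * b ∧ (toPolynomial S e).coeff 0 ≠ 0 := by
    by_contra! hcon
    refine hd0 ?_
    obtain ⟨d', hd', hd0'⟩ : ∃ d' : AddMonoidAlgebra K S, algebraMap _ F d' = algebraMap _ F d ∧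
        (toPolynomial S d').coeff 0 = 0 := by
      refine FractionalIdeal.mul_induction_on hd (fun a ha b hb => ?_) ?_
      · obtain ⟨e, he⟩ := (mem_one_iff _).mp (hle (mul_mem_mul ha hb))
        exact ⟨e, he, hcon a ha b hb e he⟩
      · rintro _ _ ⟨e, rfl, he⟩ ⟨e', rfl, he'⟩
        exact ⟨e + e', map_add _ _ _, by rw [map_add, coeff_add, he, he', add_zero]⟩
    rwa [IsFractionRing.injective _ F hd'] at hd0'
  have hb0 : b ≠ 0 := by
    rintro rfl
    rw [mul_zero, map_eq_zero_iff _ (IsFractionRing.injective (AddMonoidAlgebra K S) F)] at he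
    rw [he, map_zero, coeff_zero] at he0
    exact he0 rfl
  obtain ⟨I', hI'⟩ := le_one_iff_exists_coeIdeal.mp
    (show spanSingleton (AddMonoidAlgebra K S)⁰ b * A ≤ 1 by
      rw [mul_comm]
      exact (mul_le_mul_right (spanSingleton_le_iff_mem.mpr hb) A).trans hle)
  have heI : e ∈ I' := by
    have : algebraMap _ F e ∈ (I' : FractionalIdeal (AddMonoidAlgebra K S)⁰ F) := by
      rw [hI', he, mul_comm a]
      exact mem_singleton_mul.mpr ⟨a, ha, rfl⟩
    obtain ⟨e', he', h⟩ := (mem_coeIdeal _).mp this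
    rwa [← IsFractionRing.injective _ F h]
  obtain ⟨u, hu⟩ := (IsPrincipalIdealRing.principal (I'.map (toPolynomial S))).principal
  have hI'u := eq_contraction_of_map_eq_span hn heI he0 hu
  refine ⟨b, hb0, u, ?_, ?_⟩
  · exact coeff_zero_ne_zero_of_dvd (mem_contraction.mp (hI'u ▸ heI)) he0
  · rw [← hI', hI'u]

/-- The class of the contraction of `u K[X]` depends only on `u` modulo the conductor. -/
theorem exists_contraction_eq_spanSingleton_mul {n : ℕ} (hn : ∀ k, n ≤ k → k ∈ S)
    (F : Type*) [Field F] [Algebra (AddMonoidAlgebra K S) F]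
    [IsFractionRing (AddMonoidAlgebra K S) F] {p q : K[X]} (hp : p ≠ 0) (hq : q ≠ 0)
    (hpq : X ^ n ∣ q - p) :
    ∃ x : F, x ≠ 0 ∧ (contraction S p : FractionalIdeal (AddMonoidAlgebra K S)⁰ F) =
      spanSingleton (AddMonoidAlgebra K S)⁰ x * contraction S q := by
  obtain ⟨a, ha⟩ := exists_toPolynomial_eq_X_pow_mul hn p
  obtain ⟨b, hb⟩ := exists_toPolynomial_eq_X_pow_mul hn q
  have hne {r : K[X]} (hr : r ≠ 0) {c : AddMonoidAlgebra K S}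
      (hc : toPolynomial S c = X ^ n * r) : algebraMap _ F c ≠ 0 := by
    rw [Ne, map_eq_zero_iff _ (IsFractionRing.injective (AddMonoidAlgebra K S) F)]
    rintro rfl
    rw [map_zero] at hc
    exact mul_ne_zero (pow_ne_zero n X_ne_zero) hr hc.symm
  have ha0 := hne hp ha
  have hb0 := hne hq hb
  have h : Ideal.span {b} * contraction S p = Ideal.span {a} * contraction S q :=
    le_antisymm (span_mul_contraction_le hn hpq ha hb)
      (span_mul_contraction_le hn ((dvd_sub_comm).mp hpq) hb ha)
  have h' := congrArg (fun J : Ideal _ => (J : FractionalIdeal (AddMonoidAlgebra K S)⁰ F)) h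
  simp only [coeIdeal_mul, coeIdeal_span_singleton] at h'
  refine ⟨algebraMap _ F a / algebraMap _ F b, div_ne_zero ha0 hb0, ?_⟩
  rw [div_eq_inv_mul, ← spanSingleton_mul_spanSingleton, mul_assoc, ← h', ← mul_assoc,
    spanSingleton_mul_spanSingleton, inv_mul_cancel₀ hb0, spanSingleton_one, one_mul]

end NumericalMonoidAlgebra

open Polynomial NumericalMonoidAlgebra in
theorem mainTheorem3 {K : Type*} [Field K] (hK : IsHilbertian K)
    (S : AddSubmonoid ℕ) (hS : IsNumericalMonoid S)
    (c : VClassGroup (AddMonoidAlgebra K S) (FractionRing (AddMonoidAlgebra K S))) :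
    {P : Ideal (AddMonoidAlgebra K S) | IsPrimeDivisorInClass c P}.Infinite := by
  obtain ⟨I, rfl⟩ := QuotientGroup.mk_surjective c
  obtain ⟨m, hm, -⟩ := exists_conductor hS
  -- a positive exponent keeps the constant coefficient of `u + y Xⁿ` equal to that of `u`
  obtain ⟨n, hn0, hn⟩ : ∃ n, n ≠ 0 ∧ ∀ k, n ≤ k → k ∈ S :=
    ⟨m + 1, m.succ_ne_zero, fun k hk => hm k (by omega)⟩
  obtain ⟨x, hx, u, hu, hxI⟩ := exists_spanSingleton_mul_eq_contraction hS I
  refine ((hK.infinite_irreducible_add_C_mul_X_pow hu hn0).image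
    (contraction_add_C_mul_X_pow_injOn hn hn0 hu)).mono ?_
  rintro _ ⟨y, hy, rfl⟩
  have hp0 : (u + C y * X ^ n).coeff 0 ≠ 0 := by
    rwa [coeff_add, coeff_C_mul, coeff_X_pow, if_neg hn0.symm, mul_zero, add_zero]
  have hu0 : u ≠ 0 := by
    rintro rfl
    exact hu (coeff_zero 0)
  obtain ⟨z, hz, hzu⟩ := exists_contraction_eq_spanSingleton_mul hn
    (FractionRing (AddMonoidAlgebra K S)) hy.ne_zero hu0 (q := u) ⟨-C y, by ring⟩
  obtain ⟨J, hJ, hJI⟩ := FractionalVIdeal.exists_unit_toFractionalIdeal_eq I (mul_ne_zero hz hx)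
  refine ⟨isPrime_contraction hy, height_contraction hn hy hp0, J, ?_, hJI⟩
  rw [hJ, hzu, ← hxI, ← mul_assoc, FractionalIdeal.spanSingleton_mul_spanSingleton]
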